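/- Let $\mathcal A$ be a finite alphabet with $|\mathcal A|\ge 2$, and give $\mathcal A^{\mathbb N}$ the metric $d(x,y)=|\mathcal A|^{-\min\{k\ge 0\,:\,x_k\ne y_k\}}$ for $x\neq y$. A position is a finite word over $\mathcal A$; write $\mathrm{len}(p)$ for its length and $[T_p]$ for the set of $x\in\mathcal A^{\mathbb N}$ having $p$ as a prefix. For a set $P$ of nonempty positions let $P_{\mathrm{concat}}=\{p_1\circ p_2\circ p_3\circ\cdots : p_i\in P\}\subseteq\mathcal A^{\mathbb N}$. For $W\subseteq\mathcal A^{\mathbb N}$, in the game with winning set $W$ two players alternately choose letters $a_0,a_1,a_2,\dots$ of $\mathcal A$ (Player 1 those of even index, Player 2 those of odd index, both knowing all previous choices), and Player 1 wins if $\langle a_0,a_1,\dots\rangle\in W$. Let $Z$ be a finite set of nonempty positions, none of which is a prefix of another. (1) If all positions in $Z$ have even length, then $$\dim_H(Z_{\mathrm{concat}})<\tfrac12\quad\Longleftrightarrow\quad\sum_{p\in Z}|\mathcal A|^{-\mathrm{len}(p)/2}<1 .$$ (2) Consequently, the Bellaïche–Rosenzweig dimension criterion is equivalent to the sum condition for the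 open set $W=\bigcup_{p\in Z}[T_p]$, where now the lengths may have any parity. Precisely, let $Z'$ be obtained from $Z$ by keeping the positions of even length and replacing each $p\in Z$ of odd length by the positions $p\circ\langle a\rangle$, $a\in\mathcal A$ (so that $W=\bigcup_{q\in Z'}[T_q]$). Then Player 1 has a winning strategy in the game with winning set $W$ if and only if she has one in the game with winning set $Z'_{\mathrm{concat}}$; moreover $$\dim_H(Z'_{\mathrm{concat}})\ge\tfrac12\quad\Longleftrightarrow\quad\sum_{p\in Z}|\mathcal A|^{-\lfloor\mathrm{len}(p)/2\rfloor}\ge 1 ;$$ and hence the criterion "if Player 1 has a winning strategy for $Z'_{\mathrm{concat}}$, then $\dim_H(Z'_{\mathrm{concat}})\ge\frac12$" is equivalent to the criterion "if Player 1 has a winning strategy for $W$, then $\sum_{p\in Z}|\mathcal A|^{-\lfloor\mathrm{len}(p)/2\rfloor}\ge1$". -/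

import Mathlib

open scoped ENNReal

/-- The infinite sequences of actions, i.e. the boundary `[T]` of the full tree over `A`. -/
def Play (A : Type*) : Type _ := ℕ → A

/-- The standard ultrametric on plays over a finite alphabet: two different plays whose first
disagreement is at index `k` (indices start at `0`) have distance `|A| ^ (-k)`. -/
noncomputable instance Play.instMetricSpace (A : Type*) [Fintype A] : MetricSpace (Play A) := by
  classical
  have h0 : (0 : ℝ) ≤ (Fintype.card A : ℝ)⁻¹ := by positivity
  have h1 : (Fintype.card A : ℝ)⁻¹ ≤ 1 := Nat.cast_inv_le_one _
  exact
    { dist := fun x y =>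
        if x = y then 0 else ((Fintype.card A : ℝ)⁻¹) ^ (PiNat.firstDiff (E := fun _ => A) x y)
      dist_self := fun x => by simp
      dist_comm := fun x y => by
        simp only [eq_comm (a := x) (b := y), PiNat.firstDiff_comm (E := fun _ => A) x y]
      dist_triangle := fun x y z => by
        by_cases hxz : x = z
        · simp only [hxz, if_true]
          split_ifs <;> positivity
        by_cases hxy : x = y
        · subst hxy; simp
        by_cases hyz : y = z
        · subst hyz; simp
        simp only [hxz, hxy, hyz, if_false]
        have hm := PiNat.min_firstDiff_le (E := fun _ => A) x y z hxz
        rcases min_le_iff.1 hm with h | h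
        · exact (pow_le_pow_of_le_one h0 h1 h).trans (le_add_of_nonneg_right (by positivity))
        · exact (pow_le_pow_of_le_one h0 h1 h).trans (le_add_of_nonneg_left (by positivity))
      eq_of_dist_eq_zero := fun {x y} h => by
        by_contra hxy
        simp only [hxy, if_false] at h
        have : Nonempty A := ⟨x 0⟩
        have hc : (0 : ℝ) < (Fintype.card A : ℝ)⁻¹ :=
          inv_pos.2 (Nat.cast_pos.2 Fintype.card_pos)
        exact (pow_pos hc _).ne' h }

theorem Play.dist_of_ne {A : Type*} [Fintype A] {x y : Play A} (h : x ≠ y) :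
    dist x y = ((Fintype.card A : ℝ)⁻¹) ^ (PiNat.firstDiff (E := fun _ => A) x y) := by
  classical
  exact if_neg h

/-- The finite position `p` is a prefix of the play `x`. -/
def IsPrefixOf {A : Type*} (p : List A) (x : Play A) : Prop :=
  ∀ (i : ℕ) (h : i < p.length), p[i] = x i

/-- The winning set `⋃_{p ∈ Z} [T_p]`, consisting of the plays with a prefix in `Z`. -/
def openSet {A : Type*} (Z : Set (List A)) : Set (Play A) :=
  {x | ∃ p ∈ Z, IsPrefixOf p x}

/-- `Z_concat`: the plays of the form `p₀ ∘ p₁ ∘ p₂ ∘ ⋯` with all `pᵢ ∈ Z`, i.e. such that every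
finite concatenation `p₀ ∘ ⋯ ∘ pₙ₋₁` is a prefix (for sets `Z` of nonempty positions, these
prefixes determine the play). -/
def concatSet {A : Type*} (Z : Set (List A)) : Set (Play A) :=
  {x | ∃ p : ℕ → List A, (∀ i, p i ∈ Z) ∧
    ∀ n : ℕ, IsPrefixOf ((List.range n).map p).flatten x}

/-- The positions of even length that describe the same open set as `Z`: those of even length
are kept, and each one of odd length is replaced by all its extensions by one action. -/
def evenExt {A : Type*} (Z : Set (List A)) : Set (List A) :=
  {q | (q ∈ Z ∧ Even q.length) ∨ ∃ p ∈ Z, Odd p.length ∧ ∃ a : A, q = p ++ [a]}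

/-- No element of `Z` is a prefix of another one. -/
def IsPrefixFree {A : Type*} (Z : Set (List A)) : Prop :=
  ∀ p ∈ Z, ∀ q ∈ Z, p <+: q → p = q

/-- Strategies of Player 1 in the full tree: an action for each position of even length. -/
def Strategy₁ (A : Type*) : Type _ := {p : List A // Even p.length} → A

/-- Strategies of Player 2 in the full tree: an action for each position of odd length. -/
def Strategy₂ (A : Type*) : Type _ := {p : List A // Odd p.length} → A

/-- The action chosen at position `p` when the players follow `s₁` and `s₂`. -/
def nextAction {A : Type*} (s₁ : Strategy₁ A) (s₂ : Strategy₂ A) (p : List A) : A :=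
  if h : Even p.length then s₁ ⟨p, h⟩ else s₂ ⟨p, Nat.not_even_iff_odd.1 h⟩

/-- The position reached after `n` stages. -/
def positionAt {A : Type*} (s₁ : Strategy₁ A) (s₂ : Strategy₂ A) : ℕ → List A
  | 0 => []
  | n + 1 => positionAt s₁ s₂ n ++ [nextAction s₁ s₂ (positionAt s₁ s₂ n)]

/-- The play `x(s₁, s₂)`. -/
def inducedPlay {A : Type*} (s₁ : Strategy₁ A) (s₂ : Strategy₂ A) : Play A :=
  fun n => nextAction s₁ s₂ (positionAt s₁ s₂ n)

/-- Player 1 has a winning strategy in the game on the full tree with winning set `W`. -/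
def Player1Wins {A : Type*} (W : Set (Play A)) : Prop :=
  ∃ s₁ : Strategy₁ A, ∀ s₂ : Strategy₂ A, inducedPlay s₁ s₂ ∈ W

/-! ### Positions and plays -/

/-! For a prefix-free `Z`, `concatSet Z` is self-similar: it is the disjoint union of its images
under x ↦ p ∘ x, which contract by |A|^(-len p). Its dimension is thus governed by Moran's sum f(t)
= ∑ |A|^(-t · len p). If f(t) ≤ 1, the n-fold concatenations give ever finer covers with t-sum
f(t)^n ≤ 1, so the dimension is at most t (`dimH_concatSet_le`). If f(t) ≥ 1 with t > 0, choosing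
independent random words with normalized weights gives a measure to which the mass distribution
principle applies, so the dimension is at least t (`le_dimH_concatSet`). Continuity of f at 1/2
yields the strict inequality. For the games, `evenExt` leaves the open set unchanged and makes all
lengths even. After each completed word Player 1 is again on move, so she can restart a strategy
that wins the open game and complete words forever (`Player1Wins.concatSet_of_openSet`). The
converse is an inclusion of winning sets. -/

theorem IsPrefixOf.of_prefix {A : Type*} {p q : List A} {x : Play A} (hp : IsPrefixOf p x)
    (h : q <+: p) : IsPrefixOf q x := by
  intro i hi
  rw [h.getElem hi]
  exact hp i _

theorem IsPrefixOf.prefix_of_length_le {A : Type*} {p q : List A} {x : Play A}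
    (hp : IsPrefixOf p x) (hq : IsPrefixOf q x) (h : p.length ≤ q.length) : p <+: q := by
  rw [List.prefix_iff_getElem]
  exact ⟨h, fun i hi => by rw [hp i hi, hq i]⟩

theorem isPrefixOf_nil {A : Type*} (x : Play A) : IsPrefixOf [] x := fun i h => by simp at h

/-- The concatenation of the first `n` terms of a sequence of positions. -/
def concatWord {A : Type*} (w : ℕ → List A) (n : ℕ) : List A := ((List.range n).map w).flatten

theorem concatWord_zero {A : Type*} (w : ℕ → List A) : concatWord w 0 = [] := by
  simp [concatWord]

theorem concatWord_succ {A : Type*} (w : ℕ → List A) (n : ℕ) :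
    concatWord w (n + 1) = concatWord w n ++ w n := by
  simp [concatWord, List.range_succ]

theorem concatWord_congr {A : Type*} {v w : ℕ → List A} {n : ℕ} (h : ∀ i < n, v i = w i) :
    concatWord v n = concatWord w n := by
  unfold concatWord
  congr 1
  exact List.map_congr_left fun i hi => h i (List.mem_range.1 hi)

theorem length_concatWord {A : Type*} (w : ℕ → List A) (n : ℕ) :
    (concatWord w n).length = ∑ i ∈ Finset.range n, (w i).length := by
  induction n with
  | zero => simp [concatWord_zero]
  | succ n ih => rw [concatWord_succ, List.length_append, ih, Finset.sum_range_succ]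

theorem concatWord_prefix {A : Type*} (w : ℕ → List A) {m n : ℕ} (h : m ≤ n) :
    concatWord w m <+: concatWord w n := by
  induction n, h using Nat.le_induction with
  | base => exact List.prefix_rfl
  | succ n _ ih => exact ih.trans (by rw [concatWord_succ]; exact List.prefix_append _ _)

theorem le_length_concatWord {A : Type*} {w : ℕ → List A} (hw : ∀ i, w i ≠ []) (n : ℕ) :
    n ≤ (concatWord w n).length := by
  rw [length_concatWord]
  calc n = ∑ i ∈ Finset.range n, 1 := by simp
    _ ≤ _ := Finset.sum_le_sum fun i _ => List.length_pos_iff.2 (hw i)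

/-- The infinite concatenation of a sequence of nonempty positions. -/
noncomputable def infConcat {A : Type*} [Nonempty A] (w : ℕ → List A) : Play A :=
  -- If all words are nonempty, the first k + 1 of them have more than k letters in total, so the
  -- default letter is never used.
  fun k => (concatWord w (k + 1)).getD k (Classical.arbitrary A)

theorem isPrefixOf_infConcat {A : Type*} [Nonempty A] {w : ℕ → List A} (hw : ∀ i, w i ≠ [])
    (n : ℕ) : IsPrefixOf (concatWord w n) (infConcat w) := by
  intro i hi
  have h1 : i < (concatWord w (i + 1)).length := le_length_concatWord hw (i + 1)
  unfold infConcat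
  rw [List.getD_eq_getElem _ _ h1]
  rcases le_total n (i + 1) with h | h
  · exact (concatWord_prefix w h).getElem hi
  · exact ((concatWord_prefix w h).getElem h1).symm

theorem infConcat_mem_concatSet {A : Type*} [Nonempty A] {Z : Set (List A)}
    (hne : ∀ p ∈ Z, p ≠ []) {w : ℕ → List A} (hw : ∀ i, w i ∈ Z) :
    infConcat w ∈ concatSet Z :=
  ⟨w, hw, fun n => isPrefixOf_infConcat (fun i => hne _ (hw i)) n⟩

theorem concatSet_subset_openSet {A : Type*} (Z : Set (List A)) : concatSet Z ⊆ openSet Z := by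
  rintro x ⟨w, hw, hx⟩
  exact ⟨w 0, hw 0, by simpa using hx 1⟩

/-- A play that extends every finite concatenation reached by one more position of `Z` lies
in `concatSet Z`. -/
theorem mem_concatSet_of_forall_extend {A : Type*} {Z : Set (List A)} {x : Play A}
    (h : ∀ (n : ℕ) (w : ℕ → List A), (∀ i < n, w i ∈ Z) → IsPrefixOf (concatWord w n) x →
      ∃ q ∈ Z, IsPrefixOf (concatWord w n ++ q) x) : x ∈ concatSet Z := by
  classical
  let good : List A → Prop := fun p =>
    ∃ (n : ℕ) (w : ℕ → List A), (∀ i < n, w i ∈ Z) ∧ concatWord w n = p ∧ IsPrefixOf p x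
  have hnil : good [] := ⟨0, fun _ => [], by simp, concatWord_zero _, isPrefixOf_nil x⟩
  have step : ∀ p : {p // good p}, ∃ q ∈ Z, good (p.1 ++ q) := by
    rintro ⟨p, n, w, hw, rfl, hp⟩
    obtain ⟨q, hq, hpq⟩ := h n w hw hp
    refine ⟨q, hq, n + 1, fun i => if i < n then w i else q, ?_, ?_, hpq⟩
    · intro i hi
      by_cases hin : i < n
      · simpa [hin] using hw i hin
      · simpa [hin] using hq
    · rw [concatWord_succ, concatWord_congr (w := w) fun i hi => by simp [hi]]
      simp
  choose f hf hgood using step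
  let g : ℕ → {p // good p} := fun n => Nat.rec ⟨[], hnil⟩ (fun _ p => ⟨p.1 ++ f p, hgood p⟩) n
  have hg : ∀ n, concatWord (fun i => f (g i)) n = (g n).1 := by
    intro n
    induction n with
    | zero => exact concatWord_zero _
    | succ n ih => rw [concatWord_succ, ih]
  refine ⟨fun i => f (g i), fun i => hf _, fun n => ?_⟩
  change IsPrefixOf (concatWord (fun i => f (g i)) n) x
  rw [hg]
  obtain ⟨_, _, _, _, hx⟩ := (g n).2
  exact hx

/-! ### The even extension -/

theorem openSet_evenExt {A : Type*} (Z : Set (List A)) : openSet (evenExt Z) = openSet Z := by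
  ext x
  constructor
  · rintro ⟨q, ⟨hq, -⟩ | ⟨p, hp, -, a, rfl⟩, hx⟩
    · exact ⟨q, hq, hx⟩
    · exact ⟨p, hp, hx.of_prefix (List.prefix_append _ _)⟩
  · rintro ⟨p, hp, hx⟩
    rcases Nat.even_or_odd p.length with h | h
    · exact ⟨p, Or.inl ⟨hp, h⟩, hx⟩
    · refine ⟨p ++ [x p.length], Or.inr ⟨p, hp, h, _, rfl⟩, fun i hi => ?_⟩
      rw [List.getElem_append]
      split_ifs with h'
      · exact hx i h'
      · simp only [List.length_append, List.length_singleton] at hi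
        have : i = p.length := by omega
        simp [this]

theorem even_length_of_mem_evenExt {A : Type*} {Z : Set (List A)} {q : List A}
    (hq : q ∈ evenExt Z) : Even q.length := by
  obtain ⟨-, h⟩ | ⟨p, -, h, a, rfl⟩ := hq
  · exact h
  · simpa using h.add_one

theorem ne_nil_of_mem_evenExt {A : Type*} {Z : Set (List A)} (hne : ∀ p ∈ Z, p ≠ [])
    {q : List A} (hq : q ∈ evenExt Z) : q ≠ [] := by
  obtain ⟨h, -⟩ | ⟨p, -, -, a, rfl⟩ := hq
  · exact hne q h
  · simp

/-- Comparable words in the extension come from comparable, hence equal, words of `Z`; parity rules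
out the mixed cases. -/
theorem IsPrefixFree.evenExt {A : Type*} {Z : Set (List A)} (hZ : IsPrefixFree Z) :
    IsPrefixFree (evenExt Z) := by
  have key : ∀ p ∈ Z, ∀ q ∈ Z, ∀ b : A, p <+: q ++ [b] → p = q := by
    intro p hp q hq b h
    rcases List.prefix_concat_iff.1 h with h | h
    · have := hZ q hq p hp (by rw [h]; exact List.prefix_append _ _)
      exact this.symm
    · exact hZ p hp q hq h
  rintro p (⟨hp, hpe⟩ | ⟨p, hp, hpo, a, rfl⟩) q (⟨hq, hqe⟩ | ⟨q, hq, hqo, b, rfl⟩) h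
  · exact hZ p hp q hq h
  · obtain rfl := key p hp q hq b h
    exact absurd hpe (Nat.not_even_iff_odd.2 hqo)
  · obtain rfl := hZ p hp q hq ((List.prefix_append _ _).trans h)
    exact absurd hqe (Nat.not_even_iff_odd.2 hpo)
  · obtain rfl := key p hp q hq b ((List.prefix_append _ _).trans h)
    exact h.eq_of_length (by simp)

/-! ### Games -/

/-- Repeatedly remove a prefix in `Z` from a position, as long as there is one. -/
noncomputable def stripPrefixes {A : Type*} (Z : Set (List A)) (p : List A) : List A :=
  open Classical in
  if h : ∃ q ∈ Z, q ≠ [] ∧ q <+: p then stripPrefixes Z (p.drop h.choose.length) else p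
termination_by p.length
decreasing_by
  have h1 := List.length_pos_iff.2 h.choose_spec.2.1
  have h2 := h.choose_spec.2.2.length_le
  rw [List.length_drop]
  omega

theorem stripPrefixes_of_forall {A : Type*} {Z : Set (List A)} {p : List A}
    (h : ∀ q ∈ Z, ¬ q <+: p) : stripPrefixes Z p = p := by
  rw [stripPrefixes, dif_neg]
  rintro ⟨q, hq, -, hqp⟩
  exact h q hq hqp

theorem stripPrefixes_append {A : Type*} {Z : Set (List A)} (hfree : IsPrefixFree Z)
    {q : List A} (hq : q ∈ Z) (hq0 : q ≠ []) (p : List A) :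
    stripPrefixes Z (q ++ p) = stripPrefixes Z p := by
  have h : ∃ r ∈ Z, r ≠ [] ∧ r <+: q ++ p := ⟨q, hq, hq0, List.prefix_append _ _⟩
  -- Two prefixes of one word are comparable, so prefix-freeness makes the choice unique.
  have hr : h.choose = q := by
    obtain ⟨h1, -, h3⟩ := h.choose_spec
    rcases List.prefix_or_prefix_of_prefix h3 (List.prefix_append q p) with h' | h'
    · exact hfree _ h1 _ hq h'
    · exact (hfree _ hq _ h1 h').symm
  rw [stripPrefixes, dif_pos h, hr, List.drop_left]

theorem stripPrefixes_concatWord_append {A : Type*} {Z : Set (List A)} (hfree : IsPrefixFree Z)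
    (hne : ∀ p ∈ Z, p ≠ []) {w : ℕ → List A} {n : ℕ} (hw : ∀ i < n, w i ∈ Z) (p : List A) :
    stripPrefixes Z (concatWord w n ++ p) = stripPrefixes Z p := by
  induction n generalizing p with
  | zero => simp [concatWord_zero]
  | succ n ih =>
    have hn := hw n (Nat.lt_succ_self n)
    rw [concatWord_succ, List.append_assoc, ih fun i hi => hw i (hi.trans n.lt_succ_self),
      stripPrefixes_append hfree hn (hne _ hn)]

theorem length_positionAt {A : Type*} (s₁ : Strategy₁ A) (s₂ : Strategy₂ A) (n : ℕ) :
    (positionAt s₁ s₂ n).length = n := by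
  induction n with
  | zero => rfl
  | succ n ih => simp [positionAt, ih]

theorem isPrefixOf_positionAt {A : Type*} (s₁ : Strategy₁ A) (s₂ : Strategy₂ A) (n : ℕ) :
    IsPrefixOf (positionAt s₁ s₂ n) (inducedPlay s₁ s₂) := by
  induction n with
  | zero => exact isPrefixOf_nil _
  | succ n ih =>
    intro i hi
    simp only [positionAt, List.getElem_append]
    split_ifs with h
    · exact ih i h
    · simp only [positionAt, List.length_append, List.length_singleton, length_positionAt] at h hi
      have : i = n := by omega
      simp [this, inducedPlay]

theorem IsPrefixOf.eq_positionAt {A : Type*} {s₁ : Strategy₁ A} {s₂ : Strategy₂ A} {p : List A}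
    (hp : IsPrefixOf p (inducedPlay s₁ s₂)) : p = positionAt s₁ s₂ p.length :=
  (hp.prefix_of_length_le (isPrefixOf_positionAt s₁ s₂ _) (length_positionAt s₁ s₂ _).ge).eq_of_length
    (length_positionAt s₁ s₂ _).symm

/-- Play `s₁`, starting anew each time that a position of `Z` has been completed. -/
noncomputable def restartStrategy {A : Type*} (Z : Set (List A)) (s₁ : Strategy₁ A) :
    Strategy₁ A :=
  fun p => if h : Even (stripPrefixes Z p.1).length then s₁ ⟨stripPrefixes Z p.1, h⟩
    -- Stripping words of even length preserves parity, so for such `Z` this branch is never taken.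
    else s₁ ⟨[], by simp⟩

theorem Player1Wins.concatSet_of_openSet {A : Type*} {Z : Set (List A)} (hfree : IsPrefixFree Z)
    (hne : ∀ p ∈ Z, p ≠ []) (heven : ∀ p ∈ Z, Even p.length) (h : Player1Wins (openSet Z)) :
    Player1Wins (concatSet Z) := by
  obtain ⟨s₁, hs₁⟩ := h
  refine ⟨restartStrategy Z s₁, fun s₂ => mem_concatSet_of_forall_extend fun n w hw hx => ?_⟩
  set r := concatWord w n with hr
  have hreven : Even r.length := by
    rw [hr, length_concatWord]
    exact Finset.even_sum _ fun i hi => heven _ (hw i (Finset.mem_range.1 hi))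
  -- The opponent as seen from `r`: since `s₁` beats it, the play after `r` completes a further word
  -- `q`.
  let s₂' : Strategy₂ A := fun p => s₂ ⟨r ++ p.1, by
    rw [List.length_append]; exact hreven.add_odd p.2⟩
  obtain ⟨q, hq, hqx⟩ := hs₁ s₂'
  refine ⟨q, hq, ?_⟩
  have hpos : ∀ i ≤ q.length, positionAt (restartStrategy Z s₁) s₂ (r.length + i) =
      r ++ positionAt s₁ s₂' i := by
    intro i hi
    induction i with
    | zero => simpa [positionAt] using hx.eq_positionAt.symm
    | succ i ih =>
      rw [← add_assoc, positionAt, ih (by omega), positionAt, List.append_assoc]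
      congr 3
      set p := positionAt s₁ s₂' i with hp
      have hplen : p.length = i := length_positionAt _ _ _
      have hstrip : stripPrefixes Z (r ++ p) = p := by
        rw [hr, stripPrefixes_concatWord_append hfree hne hw]
        -- Here `p` is a proper prefix of `q`, so a word of `Z` inside `p` would contradict
        -- prefix-freeness.
        refine stripPrefixes_of_forall fun q' hq' hq'p => ?_
        have hpq : p <+: q :=
          (isPrefixOf_positionAt s₁ s₂' i).prefix_of_length_le hqx (by rw [← hp]; omega)
        have := hfree _ hq' _ hq (hq'p.trans hpq)
        have := hq'p.length_le
        subst q'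
        omega
      by_cases hpe : Even p.length
      · have : Even (r ++ p).length := by
          rw [List.length_append]; exact hreven.add hpe
        simp only [nextAction, dif_pos this, dif_pos hpe, restartStrategy, hstrip]
      · have : ¬ Even (r ++ p).length := by
          rw [List.length_append, Nat.even_add]; tauto
        simp only [nextAction, dif_neg this, dif_neg hpe, s₂']
  have := isPrefixOf_positionAt (restartStrategy Z s₁) s₂ (r.length + q.length)
  rwa [hpos _ le_rfl, ← hqx.eq_positionAt] at this

theorem Player1Wins.mono {A : Type*} {V W : Set (Play A)} (hVW : V ⊆ W) (h : Player1Wins V) :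
    Player1Wins W :=
  h.imp fun _ hs s₂ => hVW (hs s₂)

theorem player1Wins_openSet_iff_concatSet_evenExt {A : Type*} {Z : Set (List A)}
    (hfree : IsPrefixFree Z) (hne : ∀ p ∈ Z, p ≠ []) :
    Player1Wins (openSet Z) ↔ Player1Wins (concatSet (evenExt Z)) := by
  rw [← openSet_evenExt]
  exact ⟨.concatSet_of_openSet hfree.evenExt (fun _ => ne_nil_of_mem_evenExt hne)
    fun _ => even_length_of_mem_evenExt, .mono (concatSet_subset_openSet _)⟩

/-! ### The metric on plays -/

theorem Play.edist_of_ne {A : Type*} [Fintype A] {x y : Play A} (h : x ≠ y) :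
    edist x y = (Fintype.card A : ℝ≥0∞)⁻¹ ^ (PiNat.firstDiff (E := fun _ => A) x y) := by
  have : Nonempty A := ⟨x 0⟩
  rw [edist_dist, Play.dist_of_ne h, ENNReal.ofReal_pow (by positivity),
    ENNReal.ofReal_inv_of_pos (by exact_mod_cast Fintype.card_pos), ENNReal.ofReal_natCast]

theorem Play.edist_le_of_forall_eq {A : Type*} [Fintype A] {x y : Play A} {k : ℕ}
    (h : ∀ i < k, x i = y i) : edist x y ≤ (Fintype.card A : ℝ≥0∞)⁻¹ ^ k := by
  by_cases hxy : x = y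
  · simp [hxy]
  have : Nonempty A := ⟨x 0⟩
  rw [Play.edist_of_ne hxy]
  refine pow_le_pow_right_of_le_one' ?_ ?_
  · exact ENNReal.inv_le_one.2 (by exact_mod_cast Fintype.card_pos)
  · by_contra hlt
    exact PiNat.apply_firstDiff_ne (E := fun _ => A) hxy (h _ (not_le.1 hlt))

theorem Play.eq_of_edist_le {A : Type*} [Fintype A] (hA : 2 ≤ Fintype.card A) {x y : Play A}
    {k : ℕ} (h : edist x y ≤ (Fintype.card A : ℝ≥0∞)⁻¹ ^ k) {i : ℕ} (hi : i < k) :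
    x i = y i := by
  by_cases hxy : x = y
  · rw [hxy]
  rw [Play.edist_of_ne hxy] at h
  rw [← ENNReal.inv_pow, ← ENNReal.inv_pow, ENNReal.inv_le_inv] at h
  have h' : Fintype.card A ^ k ≤ Fintype.card A ^ PiNat.firstDiff (E := fun _ => A) x y := by
    exact_mod_cast h
  exact PiNat.apply_eq_of_lt_firstDiff (E := fun _ => A)
    (hi.trans_le ((Nat.pow_le_pow_iff_right (by omega)).1 h'))

theorem Play.tendsto_inv_card_pow {A : Type*} [Fintype A] (hA : 2 ≤ Fintype.card A) :
    Filter.Tendsto (fun k : ℕ => (Fintype.card A : ℝ≥0∞)⁻¹ ^ k) Filter.atTop (nhds 0) :=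
  ENNReal.tendsto_pow_atTop_nhds_zero_of_lt_one
    (ENNReal.inv_lt_one.2 (by exact_mod_cast hA))

theorem Play.ediam_le_of_isPrefixOf {A : Type*} [Fintype A] (p : List A) :
    Metric.ediam {x : Play A | IsPrefixOf p x} ≤ (Fintype.card A : ℝ≥0∞)⁻¹ ^ p.length :=
  Metric.ediam_le fun _ hx _ hy =>
    Play.edist_le_of_forall_eq fun i hi => (hx i hi).symm.trans (hy i hi)

/-! ### Upper bound for the dimension -/

theorem concatWord_eq_flatten_ofFn {A : Type*} (w : ℕ → List A) (n : ℕ) :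
    concatWord w n = (List.ofFn fun i : Fin n => w i).flatten := by
  unfold concatWord
  congr 1
  exact List.ext_getElem (by simp) fun i _ _ => by simp

/-- The cylinders of n-fold concatenations cover the set. Their diameter bounds are multiplicative
in the words, so the t-sum is at most the n-th power of the one-word sum. -/
theorem dimH_concatSet_le {A : Type*} [Fintype A] (hA : 2 ≤ Fintype.card A) (Z : Finset (List A))
    (hne : ∀ p ∈ Z, p ≠ []) (t : NNReal)
    (hsum : ∑ p ∈ Z, ((Fintype.card A : ℝ≥0∞)⁻¹ ^ (t : ℝ)) ^ p.length ≤ 1) :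
    dimH (concatSet (Z : Set (List A))) ≤ t := by
  borelize (Play A)
  refine dimH_le_of_hausdorffMeasure_ne_top (ne_top_of_le_ne_top ENNReal.one_ne_top ?_)
  set c := (Fintype.card A : ℝ≥0∞)⁻¹
  have hc1 : c ≤ 1 := ENNReal.inv_le_one.2 (by exact_mod_cast one_le_two.trans hA)
  let word : ∀ n, (Fin n → Z) → List A := fun n f => (List.ofFn fun i => (f i : List A)).flatten
  have hlen : ∀ n (f : Fin n → Z), (word n f).length = ∑ i, (f i : List A).length := by
    intro n f
    simp [word, List.length_flatten, List.sum_ofFn, List.map_ofFn]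
  have hword : ∀ n (f : Fin n → Z), n ≤ (word n f).length := by
    intro n f
    rw [hlen]
    calc n = ∑ i : Fin n, 1 := by simp
      _ ≤ _ := Finset.sum_le_sum fun i _ => List.length_pos_iff.2 (hne _ (f i).2)
  have hdiam : ∀ n (f : Fin n → Z),
      Metric.ediam {x : Play A | IsPrefixOf (word n f) x} ≤ c ^ (word n f).length :=
    fun n f => Play.ediam_le_of_isPrefixOf _
  refine (MeasureTheory.Measure.hausdorffMeasure_le_liminf_sum (t : ℝ) _
    (l := Filter.atTop) (fun n => c ^ n) (Play.tendsto_inv_card_pow hA)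
    (fun n f => {x : Play A | IsPrefixOf (word n f) x}) (.of_forall fun n f => ?_)
    (.of_forall fun n x hx => ?_)).trans ?_
  · exact (hdiam n f).trans (pow_le_pow_right_of_le_one' hc1 (hword n f))
  · obtain ⟨w, hw, hx⟩ := hx
    refine Set.mem_iUnion.2 ⟨fun i => ⟨w i, hw i⟩, ?_⟩
    have := hx n
    rwa [← concatWord, concatWord_eq_flatten_ofFn] at this
  · refine Filter.liminf_le_of_le ⟨0, by simp⟩ fun b hb => ?_
    obtain ⟨n, hn⟩ := hb.exists
    refine hn.trans ?_
    calc ∑ f : Fin n → Z, Metric.ediam {x : Play A | IsPrefixOf (word n f) x} ^ (t : ℝ)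
        ≤ ∑ f : Fin n → Z, ∏ i, (c ^ (t : ℝ)) ^ (f i : List A).length := by
          refine Finset.sum_le_sum fun f _ => ?_
          rw [Finset.prod_pow_eq_pow_sum, ← hlen, ← ENNReal.rpow_mul_natCast, mul_comm,
            ENNReal.rpow_natCast_mul]
          exact ENNReal.rpow_le_rpow (hdiam n f) t.2
      _ = (∑ p : Z, (c ^ (t : ℝ)) ^ (p : List A).length) ^ n := by
          rw [Fintype.sum_pow]
      _ ≤ 1 := by
          rw [Finset.sum_coe_sort Z fun p => (c ^ (t : ℝ)) ^ p.length]
          exact pow_le_one' hsum n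

/-! ### Lower bound for the dimension -/

/-- Unique decoding from left to right: once the earlier words agree, the next words of both
sequences start at the same place in `y`, so they are comparable and hence equal. -/
theorem IsPrefixFree.eq_of_isPrefixOf_concatWord {A : Type*} {Z : Set (List A)}
    (hZ : IsPrefixFree Z) {v w : ℕ → List A} (hv : ∀ i, v i ∈ Z) (hw : ∀ i, w i ∈ Z) {n : ℕ}
    {x y : Play A} (hvx : ∀ m, IsPrefixOf (concatWord v m) x)
    (hwy : ∀ m, IsPrefixOf (concatWord w m) y)
    (hxy : ∀ i < (concatWord v n).length, x i = y i) : ∀ i < n, w i = v i := by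
  have hvy : IsPrefixOf (concatWord v n) y := fun i hi => (hvx n i hi).trans (hxy i hi)
  intro i
  induction i using Nat.strong_induction_on with
  | _ i ih =>
    intro hi
    have h1 : IsPrefixOf (concatWord v i ++ v i) y := by
      rw [← concatWord_succ]
      exact hvy.of_prefix (concatWord_prefix v hi)
    have h2 : IsPrefixOf (concatWord v i ++ w i) y := by
      rw [← concatWord_congr fun j hj => ih j hj (hj.trans hi), ← concatWord_succ]
      exact hwy _
    rcases le_total (v i).length (w i).length with h | h
    · have := h1.prefix_of_length_le h2 (by simpa using h)
      exact (hZ _ (hv i) _ (hw i) ((List.prefix_append_right_inj _).1 this)).symm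
    · have := h2.prefix_of_length_le h1 (by simpa using h)
      exact hZ _ (hw i) _ (hv i) ((List.prefix_append_right_inj _).1 this)

theorem continuous_infConcat {A : Type*} [Fintype A] [Nonempty A] (hA : 2 ≤ Fintype.card A)
    {Z : Finset (List A)} (hne : ∀ p ∈ Z, p ≠ []) [TopologicalSpace Z] [DiscreteTopology Z] :
    Continuous fun ω : ℕ → Z => infConcat fun i => (ω i : List A) := by
  rw [continuous_iff_continuousAt]
  intro ω
  rw [ContinuousAt, EMetric.tendsto_nhds]
  intro ε hε
  obtain ⟨k, hk⟩ := ((Play.tendsto_inv_card_pow hA).eventually_lt_const hε).exists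
  have hmem : PiNat.cylinder (E := fun _ => Z) ω k ∈ nhds ω :=
    (PiNat.isOpen_cylinder _ ω k).mem_nhds (PiNat.self_mem_cylinder _ _)
  filter_upwards [hmem] with ω' hω'
  refine (Play.edist_le_of_forall_eq fun i hi => ?_).trans_lt hk
  have hcw : concatWord (fun i => (ω' i : List A)) k = concatWord (fun i => (ω i : List A)) k :=
    concatWord_congr fun j hj => by rw [hω' j hj]
  have hi' : i < (concatWord (fun i => (ω i : List A)) k).length :=
    hi.trans_le (le_length_concatWord (fun j => hne _ (ω j).2) k)
  rw [← isPrefixOf_infConcat (fun j => hne _ (ω j).2) k i hi',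
    ← isPrefixOf_infConcat (fun j => hne _ (ω' j).2) k i (hcw ▸ hi')]
  simp only [hcw]

open MeasureTheory in
/-- A probability measure on sequences of positions for which the sequences whose infinite
concatenation has a given prefix of length `k` have mass at most a constant times `b ^ k`. -/
theorem exists_measure_infConcat_le {A : Type*} [Nonempty A] {Z : Finset (List A)}
    (hne : ∀ p ∈ Z, p ≠ []) (hfree : IsPrefixFree (Z : Set (List A))) {b : ℝ≥0∞}
    (hb1 : b ≤ 1) (hsum : 1 ≤ ∑ p ∈ Z, b ^ p.length) :
    ∃ M : ℕ, ∃ μ : @Measure (ℕ → Z) (@MeasurableSpace.pi _ _ fun _ => ⊤),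
      IsProbabilityMeasure μ ∧ ∀ (k : ℕ) (x : Play A),
        b ^ M * μ {ω | ∀ i < k, infConcat (fun j => (ω j : List A)) i = x i} ≤ b ^ k := by
  let : MeasurableSpace Z := ⊤
  have hbtop : b ≠ ∞ := ne_top_of_le_ne_top ENNReal.one_ne_top hb1
  have htsum : ∑' p : Z, b ^ (p : List A).length = ∑ p ∈ Z, b ^ p.length := by
    rw [tsum_fintype, Finset.sum_coe_sort Z fun p => b ^ p.length]
  let ρ : PMF Z := PMF.normalize (fun p : Z => b ^ (p : List A).length)
    (by rw [htsum]; exact (zero_lt_one.trans_le hsum).ne')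
    (by rw [htsum]; exact ENNReal.sum_ne_top.2 fun p _ => ENNReal.pow_ne_top hbtop)
  -- The total weight is at least 1, so normalizing only decreases the weights.
  have hρ : ∀ z : Z, ρ.toMeasure {z} ≤ b ^ (z : List A).length := by
    intro z
    rw [PMF.toMeasure_apply_singleton _ _ MeasurableSpace.measurableSet_top, PMF.normalize_apply, htsum]
    exact mul_le_of_le_one_right' (ENNReal.inv_le_one.2 hsum)
  let M := Z.sup List.length
  refine ⟨M, Measure.infinitePi fun _ => ρ.toMeasure, inferInstance, fun k x => ?_⟩
  rcases Set.eq_empty_or_nonempty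
    {ω : ℕ → Z | ∀ i < k, infConcat (fun j => (ω j : List A)) i = x i} with h | ⟨ω₀, hω₀⟩
  · simp [h]
  have hne' : ∀ (ω : ℕ → Z) i, (ω i : List A) ≠ [] := fun ω i => hne _ (ω i).2
  let v : ℕ → List A := fun i => ω₀ i
  have hex : ∃ n, k < (concatWord v (n + 1)).length := ⟨k, le_length_concatWord (hne' ω₀) (k + 1)⟩
  -- `n` words of `ω₀` fit into k letters. The cut may fall inside the next word, which loses at
  -- most `M` letters and accounts for `b ^ M`.
  obtain ⟨n, hn1, hn2⟩ : ∃ n, (concatWord v n).length ≤ k ∧ k < (concatWord v (n + 1)).length := by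
    classical
    refine ⟨Nat.find hex, ?_, Nat.find_spec hex⟩
    rcases h0 : Nat.find hex with _ | m
    · simp [concatWord_zero]
    · exact not_lt.1 (Nat.find_min hex (m := m) (by omega))
  have hkM : k ≤ M + (concatWord v n).length := by
    rw [concatWord_succ, List.length_append] at hn2
    have : (v n).length ≤ M := Finset.le_sup (f := List.length) (ω₀ n).2
    omega
  have hsub : {ω : ℕ → Z | ∀ i < k, infConcat (fun j => (ω j : List A)) i = x i} ⊆
      Set.pi (Finset.range n : Set ℕ) fun i => {ω₀ i} := by
    intro ω hω i hi
    refine Subtype.ext ?_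
    refine hfree.eq_of_isPrefixOf_concatWord (v := v) (fun i => (ω₀ i).2) (fun i => (ω i).2)
      (isPrefixOf_infConcat (hne' ω₀)) (isPrefixOf_infConcat (hne' ω))
      (fun j hj => ?_) i (by simpa using hi)
    rw [hω j (by omega)]
    exact hω₀ j (by omega)
  calc _ ≤ b ^ M * ∏ i ∈ Finset.range n, b ^ (v i).length := by
        gcongr
        refine (measure_mono hsub).trans ?_
        rw [Measure.infinitePi_pi _ fun _ _ => MeasurableSpace.measurableSet_top]
        exact Finset.prod_le_prod' fun i _ => hρ _
    _ = b ^ (M + (concatWord v n).length) := by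
        rw [Finset.prod_pow_eq_pow_sum, length_concatWord, pow_add]
    _ ≤ b ^ k := pow_le_pow_right_of_le_one' hb1 hkM

open MeasureTheory in
-- Mass distribution principle: the pushed-forward measure gives a set of diameter d ≤ 1 mass at
-- most a constant times d^t, so it is dominated by a multiple of the Hausdorff measure.
theorem le_dimH_concatSet {A : Type*} [Fintype A] (hA : 2 ≤ Fintype.card A) (Z : Finset (List A))
    (hne : ∀ p ∈ Z, p ≠ []) (hfree : IsPrefixFree (Z : Set (List A))) {t : NNReal} (ht : 0 < t)
    (hsum : 1 ≤ ∑ p ∈ Z, ((Fintype.card A : ℝ≥0∞)⁻¹ ^ (t : ℝ)) ^ p.length) :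
    t ≤ dimH (concatSet (Z : Set (List A))) := by
  have : Nonempty A := Fintype.card_pos_iff.1 (by omega)
  borelize (Play A)
  set c := (Fintype.card A : ℝ≥0∞)⁻¹
  have hclt : c < 1 := ENNReal.inv_lt_one.2 (by exact_mod_cast hA)
  have hc1 : c ≤ 1 := hclt.le
  have hc0 : c ≠ 0 := ENNReal.inv_ne_zero.2 (ENNReal.natCast_ne_top _)
  have hct : c ≠ ∞ := ne_top_of_le_ne_top ENNReal.one_ne_top hc1
  set b := c ^ (t : ℝ) with hb
  have hb1 : b ≤ 1 := ENNReal.rpow_le_one hc1 t.2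
  have hb0 : b ≠ 0 := by simp [hb, ENNReal.rpow_eq_zero_iff, hc0, hct]
  have hpow : ∀ k : ℕ, b ^ k = (c ^ k) ^ (t : ℝ) := fun k => by
    rw [hb, ← ENNReal.rpow_mul_natCast, mul_comm, ENNReal.rpow_natCast_mul]
  let : MeasurableSpace Z := ⊤
  let : TopologicalSpace Z := ⊥
  have : DiscreteTopology Z := ⟨rfl⟩
  have : BorelSpace Z := ⟨borel_eq_top_of_discrete.symm⟩
  obtain ⟨M, μ, hμ, hle⟩ := exists_measure_infConcat_le hne hfree hb1 hsum
  let π : (ℕ → Z) → Play A := fun ω => infConcat fun i => (ω i : List A)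
  have hπ : Measurable π := (continuous_infConcat hA hne).measurable
  -- `M` factors come from cutting inside a word, and one more from rounding the diameter to a power
  -- of `c`.
  have hkey : b ^ (M + 1) • μ.map π ≤ μH[(t : ℝ)] := by
    refine Measure.le_hausdorffMeasure _ _ 1 one_pos fun s hs => ?_
    rcases s.eq_empty_or_nonempty with rfl | ⟨x, hx⟩
    · simp
    have hball : ∀ k : ℕ, Metric.ediam s ≤ c ^ k → b ^ M * μ.map π s ≤ b ^ k := by
      intro k hk
      have hcl : IsClosed (Metric.closedEBall x (c ^ k)) := Metric.isClosed_closedEBall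
      have hsx : s ⊆ Metric.closedEBall x (c ^ k) :=
        fun y hy => (Metric.edist_le_ediam_of_mem hy hx).trans hk
      refine le_trans ?_ (hle k x)
      gcongr
      refine (measure_mono hsx).trans ?_
      rw [Measure.map_apply hπ hcl.measurableSet]
      exact measure_mono fun ω hω i hi => Play.eq_of_edist_le hA hω hi
    rw [Measure.smul_apply, smul_eq_mul]
    rcases eq_or_ne (Metric.ediam s) 0 with h0 | h0
    -- A set of diameter 0 satisfies the bound for every k, so its mass is 0; `b < 1` needs `0 < t`.
    · have hbt : Filter.Tendsto (fun k : ℕ => b ^ k) Filter.atTop (nhds 0) :=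
        ENNReal.tendsto_pow_atTop_nhds_zero_of_lt_one (ENNReal.rpow_lt_one hclt ht)
      have hz : b ^ M * μ.map π s ≤ 0 := ge_of_tendsto' hbt fun k => hball k (h0 ▸ zero_le)
      rw [pow_succ', mul_assoc, nonpos_iff_eq_zero.1 hz, mul_zero]
      exact zero_le
    · have hex : ∃ k : ℕ, c ^ (k + 1) < Metric.ediam s :=
        (((Play.tendsto_inv_card_pow hA).comp (Filter.tendsto_add_atTop_nat 1)).eventually_lt_const
          (pos_iff_ne_zero.2 h0)).exists
      classical
      obtain ⟨k, hk1, hk2⟩ : ∃ k, Metric.ediam s ≤ c ^ k ∧ c ^ (k + 1) < Metric.ediam s := by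
        refine ⟨Nat.find hex, ?_, Nat.find_spec hex⟩
        rcases hm : Nat.find hex with _ | m
        · simpa using hs
        · exact not_lt.1 (Nat.find_min hex (m := m) (by omega))
      calc b ^ (M + 1) * μ.map π s = b * (b ^ M * μ.map π s) := by rw [pow_succ', mul_assoc]
        _ ≤ b * b ^ k := by gcongr; exact hball k hk1
        _ = (c ^ (k + 1)) ^ (t : ℝ) := by rw [← pow_succ', hpow]
        _ ≤ Metric.ediam s ^ (t : ℝ) := ENNReal.rpow_le_rpow hk2.le t.2
  refine le_dimH_of_hausdorffMeasure_ne_zero (d := t) fun h0 => ?_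
  have h1 := hkey (concatSet (Z : Set (List A)))
  rw [h0, Measure.smul_apply, smul_eq_mul] at h1
  have h2 : (1 : ℝ≥0∞) ≤ μ.map π (concatSet (Z : Set (List A))) := by
    refine le_trans ?_ (Measure.le_map_apply hπ.aemeasurable _)
    have : π ⁻¹' concatSet (Z : Set (List A)) = Set.univ :=
      Set.eq_univ_of_forall fun ω => infConcat_mem_concatSet (by simpa using hne) fun i => (ω i).2
    rw [this, measure_univ]
  have h3 := mul_eq_zero.1 (nonpos_iff_eq_zero.1 h1)
  rcases h3 with h3 | h3
  · exact pow_ne_zero _ hb0 h3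
  · simp [h3] at h2

/-! ### The sum condition -/

theorem sum_inv_card_rpow_pow_eq_ofReal {A : Type*} [Fintype A] (hA : 2 ≤ Fintype.card A)
    (Z : Finset (List A)) (t : ℝ) :
    ∑ p ∈ Z, ((Fintype.card A : ℝ≥0∞)⁻¹ ^ t) ^ p.length =
      ENNReal.ofReal (∑ p ∈ Z, (Fintype.card A : ℝ) ^ (-t * p.length)) := by
  have hpos : (0 : ℝ) < Fintype.card A := by exact_mod_cast (by omega : 0 < Fintype.card A)
  rw [ENNReal.ofReal_sum_of_nonneg fun p _ => by positivity]
  refine Finset.sum_congr rfl fun p _ => ?_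
  rw [← ENNReal.ofReal_rpow_of_pos hpos, ENNReal.ofReal_natCast, ← ENNReal.rpow_mul_natCast,
    neg_mul, ENNReal.rpow_neg, ENNReal.inv_rpow]

theorem dimH_concatSet_lt_half_iff {A : Type*} [Fintype A] (hA : 2 ≤ Fintype.card A)
    (Z : Finset (List A)) (hne : ∀ p ∈ Z, p ≠ []) (hfree : IsPrefixFree (Z : Set (List A))) :
    dimH (concatSet (Z : Set (List A))) < 1 / 2 ↔
      ∑ p ∈ Z, (Fintype.card A : ℝ) ^ (-(p.length : ℝ) / 2) < 1 := by
  have hpos : (0 : ℝ) < Fintype.card A := by exact_mod_cast (by omega : 0 < Fintype.card A)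
  let f : ℝ → ℝ := fun t => ∑ p ∈ Z, (Fintype.card A : ℝ) ^ (-t * p.length)
  have hf : ∑ p ∈ Z, (Fintype.card A : ℝ) ^ (-(p.length : ℝ) / 2) = f (1 / 2) :=
    Finset.sum_congr rfl fun p _ => by congr 1; ring
  have hcoe : ((1 / 2 : NNReal) : ℝ≥0∞) = 1 / 2 := by simp
  rw [hf]
  constructor
  · intro h
    by_contra! hle
    refine h.not_ge ?_
    rw [← hcoe]
    refine le_dimH_concatSet hA Z hne hfree (by norm_num) ?_
    rw [sum_inv_card_rpow_pow_eq_ofReal hA, ENNReal.one_le_ofReal]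
    simpa [f] using hle
  · intro h
    have hcont : Continuous f := continuous_finsetSum _ fun p _ =>
      continuous_const.rpow (by fun_prop) fun _ => Or.inl hpos.ne'
    -- The upper bound at 1/2 alone would only give `≤`; by continuity the sum stays below 1 at some
    -- smaller exponent.
    have hev : ∀ᶠ t in nhdsWithin (1 / 2 : ℝ) (Set.Iio (1 / 2)), f t < 1 :=
      (hcont.continuousAt.eventually_lt_const h).filter_mono nhdsWithin_le_nhds
    obtain ⟨t, ht, ht0, ht2⟩ := (hev.and (Ioo_mem_nhdsLT (by norm_num : (0 : ℝ) < 1 / 2))).exists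
    lift t to NNReal using ht0.le
    have hle := dimH_concatSet_le hA Z hne t (by
      rw [sum_inv_card_rpow_pow_eq_ofReal hA, ENNReal.ofReal_le_one]
      exact ht.le)
    refine hle.trans_lt ?_
    rw [← hcoe, ENNReal.coe_lt_coe, ← NNReal.coe_lt_coe]
    simpa using ht2

/-- A word of length 2m + 1 becomes |A| words of length 2m + 2, contributing |A| · |A|^(-(m+1)) =
|A|^(-m); this is where the floor comes from. -/
theorem exists_finset_evenExt {A : Type*} [Fintype A] (hA : 2 ≤ Fintype.card A)
    (Z : Finset (List A)) (hfree : IsPrefixFree (Z : Set (List A))) :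
    ∃ Y : Finset (List A), (Y : Set (List A)) = evenExt (Z : Set (List A)) ∧
      ∑ q ∈ Y, (Fintype.card A : ℝ) ^ (-(q.length : ℝ) / 2) =
        ∑ p ∈ Z, 1 / (Fintype.card A : ℝ) ^ (p.length / 2) := by
  classical
  have hpos : (0 : ℝ) < Fintype.card A := by exact_mod_cast (by omega : 0 < Fintype.card A)
  have hdouble : ∀ m : ℕ, (Fintype.card A : ℝ) ^ (-((m + m : ℕ) : ℝ) / 2) =
      1 / (Fintype.card A : ℝ) ^ m := fun m => by
    rw [show -((m + m : ℕ) : ℝ) / 2 = -(m : ℝ) by push_cast; ring, Real.rpow_neg hpos.le,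
      Real.rpow_natCast, one_div]
  let E := Z.filter fun p => Even p.length
  let O := Z.filter fun p => ¬ Even p.length
  let O' := (O ×ˢ (Finset.univ : Finset A)).image fun x => x.1 ++ [x.2]
  -- A common element would be a word of `Z` properly extending another one.
  have hdisj : Disjoint E O' := by
    rw [Finset.disjoint_left]
    intro q hq hq'
    obtain ⟨⟨p, a⟩, hp, rfl⟩ := Finset.mem_image.1 hq'
    have hpZ := (Finset.mem_filter.1 (Finset.mem_product.1 hp).1).1
    have := hfree p hpZ _ (Finset.mem_filter.1 hq).1 (List.prefix_append _ _)
    simp at this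
  refine ⟨E ∪ O', ?_, ?_⟩
  · ext q
    simp [E, O, O', evenExt, and_assoc, eq_comm]
  rw [Finset.sum_union hdisj, ← Finset.sum_filter_add_sum_filter_not Z fun p => Even p.length]
  congr 1
  · refine Finset.sum_congr rfl fun p hp => ?_
    obtain ⟨m, hm⟩ := (Finset.mem_filter.1 hp).2
    rw [hm, hdouble, show (m + m) / 2 = m by omega]
  · have hinj : Function.Injective fun x : List A × A => x.1 ++ [x.2] := by
      rintro ⟨p, a⟩ ⟨q, b⟩ h
      simpa using h
    rw [Finset.sum_image hinj.injOn, Finset.sum_product]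
    refine Finset.sum_congr rfl fun p hp => ?_
    obtain ⟨m, hm⟩ := Nat.not_even_iff_odd.1 (Finset.mem_filter.1 hp).2
    simp only [List.length_append, List.length_singleton, hm, Finset.sum_const,
      Finset.card_univ, nsmul_eq_mul]
    rw [show 2 * m + 1 + 1 = (m + 1) + (m + 1) by omega, hdouble,
      show (2 * m + 1) / 2 = m by omega, pow_succ]
    field_simp

theorem mainTheorem9 {A : Type*} [Fintype A] (hA : 2 ≤ Fintype.card A)
    (Z : Finset (List A)) (hne : ∀ p ∈ Z, p ≠ [])
    (hfree : IsPrefixFree (Z : Set (List A))) :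
    -- the dimension of `Z_concat` and the sum condition, for positions of even length
    ((∀ p ∈ Z, Even p.length) →
      (dimH (concatSet (Z : Set (List A))) < 1 / 2 ↔
        ∑ p ∈ Z, (Fintype.card A : ℝ) ^ (-(p.length : ℝ) / 2) < 1)) ∧
    -- for lengths of any parity: the two games have the same winner, ...
    (Player1Wins (openSet (Z : Set (List A))) ↔
      Player1Wins (concatSet (evenExt (Z : Set (List A))))) ∧
    -- ... the necessary conditions of the two criteria are equivalent, ...
    (1 / 2 ≤ dimH (concatSet (evenExt (Z : Set (List A)))) ↔
      1 ≤ ∑ p ∈ Z, 1 / (Fintype.card A : ℝ) ^ (p.length / 2)) ∧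
    -- ... and so are the criteria themselves
    ((Player1Wins (concatSet (evenExt (Z : Set (List A)))) →
        1 / 2 ≤ dimH (concatSet (evenExt (Z : Set (List A))))) ↔
      (Player1Wins (openSet (Z : Set (List A))) →
        1 ≤ ∑ p ∈ Z, 1 / (Fintype.card A : ℝ) ^ (p.length / 2))) := by
  obtain ⟨Y, hY, hsum⟩ := exists_finset_evenExt hA Z hfree
  have hgame := player1Wins_openSet_iff_concatSet_evenExt hfree (by simpa using hne)
  have hdim : 1 / 2 ≤ dimH (concatSet (evenExt (Z : Set (List A)))) ↔
      1 ≤ ∑ p ∈ Z, 1 / (Fintype.card A : ℝ) ^ (p.length / 2) := by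
    rw [← hY, ← hsum, ← not_lt, ← not_lt, not_iff_not]
    refine dimH_concatSet_lt_half_iff hA Y (fun q hq => ?_) (hY ▸ hfree.evenExt)
    exact ne_nil_of_mem_evenExt (Z := (Z : Set (List A))) (by simpa using hne)
      (hY ▸ Finset.mem_coe.2 hq)
  exact ⟨fun _ => dimH_concatSet_lt_half_iff hA Z hne hfree, hgame, hdim, by rw [hgame, hdim]⟩
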